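/- There exist absolute constants $K, C, c>0$ such that the following holds for all integers $d,m\ge 1$ with $m\ge K d$. Let $a_1,\dots,a_m$ be independent random vectors in $\mathbb{C}^d$, each distributed as $\tfrac{1}{\sqrt2}\,g+\tfrac{i}{\sqrt2}\,h$ with $g,h\sim\mathcal N(0,I_d)$ independent standard Gaussian vectors in $\mathbb{R}^d$. Then with probability at least $1-\exp(-cm)$, the following holds simultaneously for all $x_0\in\mathbb{C}^d$ and all $\eta\in\mathbb{R}^m$: with $b_j:=|\langle a_j,x_0\rangle|^2+\eta_j$ for $j=1,\dots,m$, every global minimizer $\hat x\in\mathbb{C}^d$ of $$x\mapsto \sum_{j=1}^m\bigl(|\langle a_j,x\rangle|^2-b_j\bigr)^2,\qquad x\in\mathbb{C}^d,$$ satisfies $$\min_{\theta\in[0,2\pi)}\|\hat x-e^{i\theta}x_0\|_2\;\le\; C\,\min\left\{\frac{\sqrt{\|\eta\|_2}}{m^{1/4}},\ \frac{\|\eta\|_2}{\|x_0\|_2\,\sqrt m}\right\},$$ where for $x_0=0$ the second term in the minimum is read as $+\infty$, so that the minimum is the first term. (That the event has probability at least $1-\exp(-cm)$ means that it contains a measurable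 set of at least this probability.) -/

import Mathlib

open MeasureTheory ProbabilityTheory

noncomputable section

/-- The law `1/√2 · N(0, I_d) + i/√2 · N(0, I_d)` on `ℂ^d`, the real and imaginary parts being
independent. -/
def complexGaussian (d : ℕ) : Measure (EuclideanSpace ℂ (Fin d)) :=
  ((stdGaussian (EuclideanSpace ℝ (Fin d))).prod (stdGaussian (EuclideanSpace ℝ (Fin d)))).map
    (fun p => WithLp.toLp 2 (fun k =>
      ((1 / √2 * p.1 k : ℝ) : ℂ) + Complex.I * ((1 / √2 * p.2 k : ℝ) : ℂ)))

/-- The intensity-based empirical loss `∑ⱼ (|⟨aⱼ, x⟩|² - bⱼ)²`. -/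
def intensityLoss {d m : ℕ} (a : Fin m → EuclideanSpace ℂ (Fin d)) (b : Fin m → ℝ)
    (x : EuclideanSpace ℂ (Fin d)) : ℝ :=
  ∑ j, (‖inner ℂ (a j) x‖ ^ 2 - b j) ^ 2

/-- The noisy intensity measurements `bⱼ = |⟨aⱼ, x₀⟩|² + ηⱼ`. -/
def intensityData {d m : ℕ} (a : Fin m → EuclideanSpace ℂ (Fin d))
    (x₀ : EuclideanSpace ℂ (Fin d)) (η : EuclideanSpace ℝ (Fin m)) : Fin m → ℝ :=
  fun j => ‖inner ℂ (a j) x₀‖ ^ 2 + η j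

/-- The distance up to a global phase, `min_{θ ∈ [0, 2π)} ‖x - e^{iθ} x₀‖₂`. It is written as an
infimum; `phaseDist_isLeast` shows that the infimum is a minimum. -/
def phaseDist {d : ℕ} (x x₀ : EuclideanSpace ℂ (Fin d)) : ℝ :=
  sInf ((fun θ : ℝ => ‖x - Complex.exp (Complex.I * θ) • x₀‖) '' Set.Ico 0 (2 * Real.pi))

/-- The rate `min {√‖η‖₂ / m^{1/4}, ‖η‖₂ / (‖x₀‖₂ √m)}`. For `x₀ = 0` the second term is read as
`+∞`, so that the minimum is the first term. -/
def intensityErrorRate {d m : ℕ} (x₀ : EuclideanSpace ℂ (Fin d)) (η : EuclideanSpace ℝ (Fin m)) :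
    ℝ :=
  open Classical in
  if x₀ = 0 then √‖η‖ / (m : ℝ) ^ (1 / 4 : ℝ)
  else min (√‖η‖ / (m : ℝ) ^ (1 / 4 : ℝ)) (‖η‖ / (‖x₀‖ * √(m : ℝ)))

theorem phaseDist_isLeast {d : ℕ} (x x₀ : EuclideanSpace ℂ (Fin d)) :
    IsLeast ((fun θ : ℝ => ‖x - Complex.exp (Complex.I * θ) • x₀‖) '' Set.Ico 0 (2 * Real.pi))
      (phaseDist x x₀) := by
  have hper : Function.Periodic
      (fun θ : ℝ => ‖x - Complex.exp (Complex.I * θ) • x₀‖) (2 * Real.pi) := by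
    intro θ
    have h : Complex.exp (Complex.I * ((θ + 2 * Real.pi : ℝ) : ℂ)) =
        Complex.exp (Complex.I * θ) := by
      rw [← Complex.exp_periodic (Complex.I * θ)]
      congr 1
      push_cast
      ring
    simp only [h]
  have himg : (fun θ : ℝ => ‖x - Complex.exp (Complex.I * θ) • x₀‖) '' Set.Ico 0 (2 * Real.pi) =
      (fun θ : ℝ => ‖x - Complex.exp (Complex.I * θ) • x₀‖) '' Set.Icc 0 (2 * Real.pi) := by
    refine Set.Subset.antisymm (Set.image_mono Set.Ico_subset_Icc_self) ?_
    rintro _ ⟨θ, hθ, rfl⟩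
    rcases hθ.2.lt_or_eq with h | h
    · exact ⟨θ, ⟨hθ.1, h⟩, rfl⟩
    · refine ⟨0, ⟨le_rfl, Real.two_pi_pos⟩, ?_⟩
      rw [h]
      exact hper.eq.symm
  have hc : IsCompact
      ((fun θ : ℝ => ‖x - Complex.exp (Complex.I * θ) • x₀‖) '' Set.Icc 0 (2 * Real.pi)) :=
    isCompact_Icc.image (by fun_prop)
  unfold phaseDist
  rw [himg]
  exact hc.isLeast_sInf ((Set.nonempty_Icc.2 Real.two_pi_pos.le).image _)

end

/-! Let `y = exp(iθ) x₀`, with the phase chosen so that `⟨x̂, y⟩` is real and nonnegative, and put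
`h = x̂ - y`, `s = x̂ + y`. Then `⟨h, s⟩` is real and `|⟨a, x̂⟩|² - |⟨a, x₀⟩|² = Re(⟨h, a⟩⟨a, s⟩)`.
Moreover `‖s‖` is at least both `‖h‖` and `‖x₀‖`. So a bound `∑ⱼ |Re(⟨h, aⱼ⟩⟨aⱼ, s⟩)| ≥ v m ‖h‖
‖s‖`, uniform over pairs with real inner product (`exists_uniform_lower_bound`), controls both the
square of the phase distance and its product with `‖x₀‖`. Comparing the loss at `x̂` and at `x₀`
bounds the same sum above by `2 √m ‖η‖`, which yields both rates. Realness of `⟨h, s⟩` cannot be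
dropped: for `s = i h` every summand vanishes.

For one pair of unit vectors, the lower bound is a Chernoff estimate: `E exp(-|Re(⟨h, a⟩⟨a, s⟩)|)`
is at most some `r < 1` independent of the dimension and the pair
(`exists_integral_exp_neg_abs_cross_le`). A net of such pairs has size exponential in `d`, which `m
≥ K d` absorbs. Passing from the net to all pairs costs a multiple of `∑ⱼ |⟨aⱼ, x⟩|²`, which is
`O(m)` on the unit sphere by a second Chernoff and net argument (`sum_sq_inner_le_of_net`). -/

/-! ### The complex Gaussian law: support, characteristic function, symmetries -/

theorem real_inner_eq_re_complex_inner {d : ℕ} (x y : EuclideanSpace ℂ (Fin d)) :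
    inner ℝ x y = (inner ℂ x y).re := by
  simp [PiLp.inner_apply, Complex.inner]

theorem continuous_realPair (d : ℕ) :
    Continuous (fun p : EuclideanSpace ℝ (Fin d) × EuclideanSpace ℝ (Fin d) =>
      (WithLp.toLp 2 (fun k =>
        ((1 / √2 * p.1 k : ℝ) : ℂ) + Complex.I * ((1 / √2 * p.2 k : ℝ) : ℂ)) :
          EuclideanSpace ℂ (Fin d))) := by
  fun_prop

instance isProbabilityMeasure_complexGaussian (d : ℕ) :
    IsProbabilityMeasure (complexGaussian d) :=
  Measure.isProbabilityMeasure_map (continuous_realPair d).aemeasurable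

theorem isOpenPosMeasure_gaussianReal (μ : ℝ) {v : NNReal} (hv : v ≠ 0) :
    (gaussianReal μ v).IsOpenPosMeasure :=
  (gaussianReal_absolutelyContinuous' μ hv).isOpenPosMeasure

instance isOpenPosMeasure_stdGaussian (d : ℕ) :
    (stdGaussian (EuclideanSpace ℝ (Fin d))).IsOpenPosMeasure := by
  have := isOpenPosMeasure_gaussianReal 0 (one_ne_zero (α := NNReal))
  rw [← map_pi_eq_stdGaussian]
  exact (PiLp.continuous_toLp 2 _).isOpenPosMeasure_map (WithLp.toLp_surjective 2)

instance isOpenPosMeasure_complexGaussian (d : ℕ) :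
    (complexGaussian d).IsOpenPosMeasure := by
  refine (continuous_realPair d).isOpenPosMeasure_map fun x => ?_
  refine ⟨(WithLp.toLp 2 fun k => √2 * (x k).re, WithLp.toLp 2 fun k => √2 * (x k).im), ?_⟩
  ext k
  have h : (√2 : ℂ) ≠ 0 := by simp
  apply Complex.ext <;> simp

/-- Real and imaginary parts of each coordinate have variance 1/2, whence the 1/4. Dependence on
`‖t‖` alone is what makes the law invariant under unitaries and under passing to orthonormal
coordinates. -/
theorem charFun_complexGaussian {d : ℕ} (t : EuclideanSpace ℂ (Fin d)) :
    charFun (complexGaussian d) t = Complex.exp (-(‖t‖ ^ 2 / 4 : ℝ)) := by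
  have hre : ∀ p : EuclideanSpace ℝ (Fin d) × EuclideanSpace ℝ (Fin d),
      inner ℝ (WithLp.toLp 2 (fun k => ((1 / √2 * p.1 k : ℝ) : ℂ) +
        Complex.I * ((1 / √2 * p.2 k : ℝ) : ℂ)) : EuclideanSpace ℂ (Fin d)) t =
      inner ℝ p.1 (WithLp.toLp 2 fun k => 1 / √2 * (t k).re) +
      inner ℝ p.2 (WithLp.toLp 2 fun k => 1 / √2 * (t k).im) := by
    intro p
    simp only [PiLp.inner_apply, Complex.inner, ← Finset.sum_add_distrib]
    refine Finset.sum_congr rfl fun k _ => ?_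
    generalize 1 / √2 = c
    simp
    ring
  have hsq : (√2)⁻¹ ^ 2 = (1 / 2 : ℝ) := by simp
  rw [charFun_apply, complexGaussian, integral_map (continuous_realPair d).aemeasurable
    (by fun_prop)]
  simp only [hre, Complex.ofReal_add, add_mul, Complex.exp_add]
  rw [integral_prod_mul (fun x : EuclideanSpace ℝ (Fin d) =>
      Complex.exp ((inner ℝ x (WithLp.toLp 2 fun k => 1 / √2 * (t k).re) : ℝ) * Complex.I))
    (fun x : EuclideanSpace ℝ (Fin d) =>
      Complex.exp ((inner ℝ x (WithLp.toLp 2 fun k => 1 / √2 * (t k).im) : ℝ) * Complex.I)),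
    ← charFun_apply, ← charFun_apply, charFun_stdGaussian, charFun_stdGaussian,
    ← Complex.exp_add]
  congr 1
  norm_cast
  simp only [EuclideanSpace.norm_sq_eq, Complex.sq_norm, Complex.normSq_apply, Real.norm_eq_abs,
    sq_abs, mul_pow, ← Finset.mul_sum, Finset.sum_add_distrib, ← sq]
  ring_nf
  rw [hsq]
  ring

/-- The coordinates of a complex Gaussian vector along an orthonormal family form a complex
Gaussian vector. -/
theorem complexGaussian_map_orthonormal {d k : ℕ} {v : Fin k → EuclideanSpace ℂ (Fin d)}
    (hv : Orthonormal ℂ v) :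
    (complexGaussian d).map (fun a => (WithLp.toLp 2 fun i => inner ℂ a (v i) :
      EuclideanSpace ℂ (Fin k))) = complexGaussian k := by
  have hm : Measurable (fun a : EuclideanSpace ℂ (Fin d) =>
      (WithLp.toLp 2 fun i => inner ℂ a (v i) : EuclideanSpace ℂ (Fin k))) := by fun_prop
  have : IsProbabilityMeasure ((complexGaussian d).map (fun a =>
      (WithLp.toLp 2 fun i => inner ℂ a (v i) : EuclideanSpace ℂ (Fin k)))) :=
    Measure.isProbabilityMeasure_map hm.aemeasurable
  refine Measure.ext_of_charFun (funext fun t => ?_)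
  have key : ∀ a : EuclideanSpace ℂ (Fin d),
      inner ℝ (WithLp.toLp 2 fun i => inner ℂ a (v i) : EuclideanSpace ℂ (Fin k)) t =
      inner ℝ a (∑ i, (starRingEnd ℂ) (t i) • v i) := by
    intro a
    rw [real_inner_eq_re_complex_inner, real_inner_eq_re_complex_inner, inner_sum,
      PiLp.inner_apply, Complex.re_sum, Complex.re_sum]
    refine Finset.sum_congr rfl fun i _ => ?_
    rw [inner_smul_right, ← Complex.conj_re]
    simp
  have hnorm : ‖∑ i, (starRingEnd ℂ) (t i) • v i‖ ^ 2 = ‖t‖ ^ 2 := by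
    rw [@norm_sq_eq_re_inner ℂ, hv.inner_sum, EuclideanSpace.norm_sq_eq]
    simp only [Complex.conj_conj, Complex.mul_conj', RCLike.re_to_complex, Complex.re_sum,
      ← Complex.ofReal_pow, Complex.ofReal_re]
  rw [charFun_complexGaussian, ← hnorm, ← charFun_complexGaussian, charFun_apply, charFun_apply,
    integral_map hm.aemeasurable (by fun_prop)]
  simp only [key]

/-- The complex Gaussian law is unitarily invariant. -/
theorem complexGaussian_map_linearIsometryEquiv {d : ℕ}
    (R : EuclideanSpace ℂ (Fin d) ≃ₗᵢ[ℂ] EuclideanSpace ℂ (Fin d)) :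
    (complexGaussian d).map R = complexGaussian d := by
  have hm : Measurable R := R.continuous.measurable
  have : IsProbabilityMeasure ((complexGaussian d).map R) :=
    Measure.isProbabilityMeasure_map hm.aemeasurable
  refine Measure.ext_of_charFun (funext fun t => ?_)
  have key : ∀ a, inner ℝ (R a) t = inner ℝ a (R.symm t) := by
    intro a
    rw [real_inner_eq_re_complex_inner, real_inner_eq_re_complex_inner,
      ← R.inner_map_map a (R.symm t), R.apply_symm_apply]
  rw [charFun_complexGaussian, ← R.symm.norm_map t, ← charFun_complexGaussian, charFun_apply,
    charFun_apply, integral_map hm.aemeasurable (by fun_prop)]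
  simp only [key]

theorem exists_integrable_exp_complexGaussian (k : ℕ) :
    ∃ c : ℝ, 0 < c ∧ Integrable (fun x => Real.exp (c * ‖x‖ ^ 2)) (complexGaussian k) := by
  let T : EuclideanSpace ℝ (Fin k) × EuclideanSpace ℝ (Fin k) →ₗ[ℝ] EuclideanSpace ℂ (Fin k) :=
    { toFun := fun p => WithLp.toLp 2 (fun k =>
        ((1 / √2 * p.1 k : ℝ) : ℂ) + Complex.I * ((1 / √2 * p.2 k : ℝ) : ℂ))
      map_add' := fun p q => by ext i; simp; ring
      map_smul' := fun c p => by ext i; simp; ring }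
  have hT : complexGaussian k = ((stdGaussian (EuclideanSpace ℝ (Fin k))).prod
      (stdGaussian (EuclideanSpace ℝ (Fin k)))).map T.toContinuousLinearMap := rfl
  have : IsGaussian (complexGaussian k) := by
    rw [hT]
    infer_instance
  exact IsGaussian.exists_integrable_exp_sq _

/-! ### A Laplace transform bounded away from 1, uniformly in the dimension -/

/-- `1 - exp(-f)` is continuous and nonnegative, and it is positive on a nonempty open set, which
has positive measure. -/
theorem integral_exp_neg_lt_one {X : Type*} [TopologicalSpace X] [MeasurableSpace X]
    [OpensMeasurableSpace X] (μ : Measure X) [IsProbabilityMeasure μ] [μ.IsOpenPosMeasure]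
    {f : X → ℝ} (hf : Continuous f) (h0 : ∀ x, 0 ≤ f x) {x₀ : X} (hx₀ : f x₀ ≠ 0) :
    ∫ x, Real.exp (-f x) ∂μ < 1 := by
  have hc : Continuous fun x => Real.exp (-f x) := by fun_prop
  have hint : Integrable (fun x => Real.exp (-f x)) μ :=
    Integrable.of_bound hc.measurable.aestronglyMeasurable 1 (ae_of_all _ fun x => by
      simpa [abs_of_pos (Real.exp_pos _)] using h0 x)
  have hpos : 0 < ∫ x, ((fun _ => 1 : X → ℝ) - fun x => Real.exp (-f x) : X → ℝ) x ∂μ := by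
    rw [integral_pos_iff_support_of_nonneg (fun x => by simpa using h0 x)
      ((integrable_const 1).sub hint)]
    refine IsOpen.measure_pos μ ?_ ⟨x₀, ?_⟩
    · exact (continuous_const.sub hc).isOpen_support
    · have hlt : Real.exp (-f x₀) < 1 := by
        simpa using (h0 x₀).lt_of_ne' hx₀
      simpa using (sub_pos.2 hlt).ne'
  simp only [Pi.sub_apply] at hpos
  rw [integral_sub (integrable_const 1) hint] at hpos
  simpa using hpos

theorem integrable_exp_neg_abs {X : Type*} [TopologicalSpace X] [MeasurableSpace X]
    [OpensMeasurableSpace X] (μ : Measure X) [IsFiniteMeasure μ]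
    {f : X → ℝ} (hf : Continuous f) : Integrable (fun x => Real.exp (-|f x|)) μ := by
  have hc : Continuous fun x => Real.exp (-|f x|) := by fun_prop
  exact Integrable.of_bound hc.measurable.aestronglyMeasurable 1 (ae_of_all _ fun x => by simp)

/-- Since `2|x| ≤ |x + y| + |x - y|`, one of the two exponentials is at most `exp(-|x|)`; the other
is at most 1. -/
theorem exp_neg_abs_add_exp_neg_abs_le (x y : ℝ) :
    Real.exp (-|x + y|) + Real.exp (-|x - y|) ≤ 1 + Real.exp (-|x|) := by
  have h1 : Real.exp (-|x + y|) ≤ 1 := by simp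
  have h2 : Real.exp (-|x - y|) ≤ 1 := by simp
  have h : |x| ≤ |x + y| ∨ |x| ≤ |x - y| := by grind
  rcases h with h | h
  · have := Real.exp_le_exp.2 (neg_le_neg h)
    linarith
  · have := Real.exp_le_exp.2 (neg_le_neg h)
    linarith

/-- Symmetrization: flipping the sign of the component of `a` along `w ⟂ h`. -/
theorem integral_exp_neg_abs_add_eq_sub {d : ℕ} {h w : EuclideanSpace ℂ (Fin d)}
    (hw : inner ℂ h w = 0) (ρ : ℝ) :
    ∫ a, Real.exp (-|ρ * ‖inner ℂ a h‖ ^ 2 + (inner ℂ h a * inner ℂ a w).re|)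
      ∂(complexGaussian d) =
    ∫ a, Real.exp (-|ρ * ‖inner ℂ a h‖ ^ 2 - (inner ℂ h a * inner ℂ a w).re|)
      ∂(complexGaussian d) := by
  let R := (Submodule.span ℂ {h}).reflection
  have hRh : R h = h :=
    Submodule.reflection_mem_subspace_eq_self (Submodule.mem_span_singleton_self h)
  have hRw : R w = -w :=
    Submodule.reflection_mem_subspace_orthogonalComplement_eq_neg
      (Submodule.mem_orthogonal_singleton_iff_inner_right.2 hw)
  have h1 : ∀ a, inner ℂ (R a) h = inner ℂ a h := fun a => by
    conv_lhs => rw [← hRh]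
    exact R.inner_map_map _ _
  have h2 : ∀ a, inner ℂ h (R a) = inner ℂ h a := fun a => by
    conv_lhs => rw [← hRh]
    exact R.inner_map_map _ _
  have h3 : ∀ a, inner ℂ (R a) w = -inner ℂ a w := fun a => by
    rw [← inner_neg_right, ← R.inner_map_map a (-w), map_neg, hRw, neg_neg]
  conv_lhs => rw [← complexGaussian_map_linearIsometryEquiv R]
  rw [integral_map R.continuous.measurable.aemeasurable
    (Continuous.aestronglyMeasurable (by fun_prop))]
  simp only [h1, h2, h3, mul_neg, Complex.neg_re, sub_eq_add_neg]

/-- By the sign symmetry the integral is the mean of those with `A + B` and `A - B`. The pointwise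
inequality can then be applied with either `A` or `B` kept, so the two terms cannot cancel each
other on average. -/
theorem integral_exp_neg_cross_le {d : ℕ} {h w : EuclideanSpace ℂ (Fin d)}
    (hw : inner ℂ h w = 0) (ρ : ℝ) :
    ∫ a, Real.exp (-|ρ * ‖inner ℂ a h‖ ^ 2 + (inner ℂ h a * inner ℂ a w).re|)
      ∂(complexGaussian d) ≤
    (1 + min (∫ a, Real.exp (-|ρ * ‖inner ℂ a h‖ ^ 2|) ∂(complexGaussian d))
      (∫ a, Real.exp (-|(inner ℂ h a * inner ℂ a w).re|) ∂(complexGaussian d))) / 2 := by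
  set μ := complexGaussian d
  have hA : Continuous fun a : EuclideanSpace ℂ (Fin d) => ρ * ‖inner ℂ a h‖ ^ 2 := by fun_prop
  have hB : Continuous fun a : EuclideanSpace ℂ (Fin d) => (inner ℂ h a * inner ℂ a w).re := by
    fun_prop
  have i1 := integrable_exp_neg_abs μ (hA.add hB)
  have i2 := integrable_exp_neg_abs μ (hA.sub hB)
  have hsum := integral_add i1 i2
  have hsym := integral_exp_neg_abs_add_eq_sub hw ρ
  have b1 := integral_mono (i1.add i2) ((integrable_const 1).add (integrable_exp_neg_abs μ hA))
    (fun a => exp_neg_abs_add_exp_neg_abs_le (ρ * ‖inner ℂ a h‖ ^ 2) _)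
  have b2 := integral_mono (i1.add i2) ((integrable_const 1).add (integrable_exp_neg_abs μ hB))
    (fun a => by
      have := exp_neg_abs_add_exp_neg_abs_le ((inner ℂ h a * inner ℂ a w).re)
        (ρ * ‖inner ℂ a h‖ ^ 2)
      rwa [abs_sub_comm, add_comm (Complex.re _)] at this)
  have e1 := integral_add (integrable_const (1 : ℝ)) (integrable_exp_neg_abs μ hA)
  have e2 := integral_add (integrable_const (1 : ℝ)) (integrable_exp_neg_abs μ hB)
  simp only [Pi.add_apply, Pi.sub_apply] at b1 b2 hsum
  simp only [integral_const, probReal_univ, one_smul] at e1 e2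
  rcases min_choice (∫ a, Real.exp (-|ρ * ‖inner ℂ a h‖ ^ 2|) ∂μ)
    (∫ a, Real.exp (-|(inner ℂ h a * inner ℂ a w).re|) ∂μ) with hm | hm <;> rw [hm] <;> linarith

theorem integral_comp_inner_eq {d : ℕ} {h : EuclideanSpace ℂ (Fin d)} (hh : ‖h‖ = 1)
    (f : ℂ → ℝ) (hf : Measurable f) :
    ∫ a, f (inner ℂ a h) ∂(complexGaussian d) = ∫ z, f (z 0) ∂(complexGaussian 1) := by
  have hv : Orthonormal ℂ (fun _ : Fin 1 => h) :=
    ⟨fun _ => hh, fun i j hij => absurd (Subsingleton.elim i j) hij⟩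
  rw [← complexGaussian_map_orthonormal hv, integral_map]
  · exact Measurable.aemeasurable (by fun_prop)
  · exact Measurable.aestronglyMeasurable (hf.comp (by fun_prop))

theorem integral_comp_inner_pair_eq {d : ℕ} {h w : EuclideanSpace ℂ (Fin d)} (hh : ‖h‖ = 1) (hw : ‖w‖ = 1)
    (hhw : inner ℂ h w = 0) (f : ℂ × ℂ → ℝ) (hf : Measurable f) :
    ∫ a, f (inner ℂ a h, inner ℂ a w) ∂(complexGaussian d) =
      ∫ z, f (z 0, z 1) ∂(complexGaussian 2) := by
  have hv : Orthonormal ℂ ![h, w] := by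
    refine ⟨fun i => by fin_cases i <;> simp [hh, hw], fun i j hij => ?_⟩
    fin_cases i <;> fin_cases j <;> simp_all [inner_eq_zero_symm]
  rw [← complexGaussian_map_orthonormal hv, integral_map]
  · simp
  · exact Measurable.aemeasurable (by fun_prop)
  · exact Measurable.aestronglyMeasurable (hf.comp (by fun_prop))

/-- Write `s = ρ h + w` with `ρ` real and `w ⟂ h`, so that `ρ² + ‖w‖² = 1` and one of `|ρ|`, `‖w‖`
is at least 1/2. The corresponding term alone gives a fixed integral over one or two complex
Gaussian coordinates, which is below 1 whatever `d` is. -/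
theorem exists_integral_exp_neg_abs_cross_le :
    ∃ r : ℝ, 0 < r ∧ r < 1 ∧ ∀ (d : ℕ) (h s : EuclideanSpace ℂ (Fin d)), ‖h‖ = 1 → ‖s‖ = 1 →
      (inner ℂ h s).im = 0 →
      ∫ a, Real.exp (-|(inner ℂ h a * inner ℂ a s).re|) ∂(complexGaussian d) ≤ r := by
  set r₁ := ∫ z, Real.exp (-(1 / 2 * ‖z 0‖ ^ 2)) ∂(complexGaussian 1) with hr₁
  set r₂ := ∫ z, Real.exp (-(1 / 2 * |((starRingEnd ℂ) (z 0) * z 1).re|)) ∂(complexGaussian 2)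
    with hr₂
  have h₁ : r₁ < 1 := integral_exp_neg_lt_one _ (by fun_prop) (fun z => by positivity)
    (x₀ := WithLp.toLp 2 fun _ => 1) (by simp)
  have h₂ : r₂ < 1 := integral_exp_neg_lt_one _ (by fun_prop) (fun z => by positivity)
    (x₀ := WithLp.toLp 2 fun _ => 1) (by simp)
  have p₁ : 0 ≤ r₁ := integral_nonneg fun z => (Real.exp_pos _).le
  have p₂ : 0 ≤ r₂ := integral_nonneg fun z => (Real.exp_pos _).le
  refine ⟨(1 + max r₁ r₂) / 2, by positivity, by linarith [max_lt h₁ h₂], ?_⟩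
  intro d h s hh hs him
  set ρ := (inner ℂ h s).re with hρ
  have hρc : inner ℂ h s = (ρ : ℂ) := Complex.ext rfl (by simpa using him)
  set w := s - (ρ : ℂ) • h with hw
  have hsw : s = (ρ : ℂ) • h + w := by simp [hw]
  have hhw : inner ℂ h w = 0 := by
    rw [hw, inner_sub_right, inner_smul_right, hρc, inner_self_eq_norm_sq_to_K, hh]
    simp
  have hpyth : ρ ^ 2 + ‖w‖ ^ 2 = 1 := by
    have := norm_add_sq_eq_norm_sq_add_norm_sq_of_inner_eq_zero ((ρ : ℂ) • h) w
      (by rw [inner_smul_left, hhw, mul_zero])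
    rw [← hsw, hs, norm_smul, hh, Complex.norm_real, mul_one, mul_one,
      Real.norm_eq_abs, abs_mul_abs_self] at this
    linarith
  have hz : ∀ a, (inner ℂ h a * inner ℂ a s).re =
      ρ * ‖inner ℂ a h‖ ^ 2 + (inner ℂ h a * inner ℂ a w).re := by
    intro a
    rw [hsw, inner_add_right, inner_smul_right, mul_add, Complex.add_re, mul_left_comm,
      ← inner_conj_symm h a, Complex.conj_mul', ← Complex.ofReal_pow, ← Complex.ofReal_mul,
      Complex.ofReal_re]
  simp only [hz]
  refine (integral_exp_neg_cross_le hhw ρ).trans ?_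
  gcongr
  by_cases hcase : 1 / 2 ≤ |ρ|
  · refine min_le_left _ _ |>.trans (le_trans ?_ (le_max_left _ _))
    rw [hr₁, ← integral_comp_inner_eq hh (fun z => Real.exp (-(1 / 2 * ‖z‖ ^ 2))) (by fun_prop)]
    refine integral_mono (integrable_exp_neg_abs _ (by fun_prop)) ?_ fun a => ?_
    · have := integrable_exp_neg_abs (complexGaussian d)
        (f := fun a => 1 / 2 * ‖inner ℂ a h‖ ^ 2) (by fun_prop)
      simpa only [abs_of_nonneg (show (0 : ℝ) ≤ 1 / 2 * ‖inner ℂ _ h‖ ^ 2 by positivity)] using this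
    · dsimp only
      rw [abs_mul, abs_of_nonneg (sq_nonneg ‖inner ℂ a h‖)]
      gcongr
  · refine min_le_right _ _ |>.trans (le_trans ?_ (le_max_right _ _))
    have hwn : 1 / 2 ≤ ‖w‖ := by
      have h1 : |ρ| ^ 2 ≤ (1 / 2) ^ 2 := by
        gcongr
        exact (not_le.1 hcase).le
      rw [sq_abs] at h1
      by_contra! hlt
      nlinarith [norm_nonneg w]
    have hw0 : (‖w‖ : ℂ) ≠ 0 := by
      norm_cast
      linarith
    set e := (‖w‖ : ℂ)⁻¹ • w with he
    have hwe : w = (‖w‖ : ℂ) • e := by rw [he, smul_smul, mul_inv_cancel₀ hw0, one_smul]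
    have hen : ‖e‖ = 1 := by
      rw [he, norm_smul, norm_inv, Complex.norm_real, norm_norm, inv_mul_cancel₀ (by linarith)]
    have hhe : inner ℂ h e = 0 := by rw [he, inner_smul_right, hhw, mul_zero]
    rw [hr₂, ← integral_comp_inner_pair_eq hh hen hhe
      (fun z => Real.exp (-(1 / 2 * |((starRingEnd ℂ) z.1 * z.2).re|))) (by fun_prop)]
    refine integral_mono (integrable_exp_neg_abs _ (by fun_prop)) ?_ fun a => ?_
    · have := integrable_exp_neg_abs (complexGaussian d)
        (f := fun a => 1 / 2 * ((starRingEnd ℂ) (inner ℂ a h) * inner ℂ a e).re) (by fun_prop)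
      simpa only [abs_mul, abs_of_pos (one_half_pos (α := ℝ))] using this
    · dsimp only
      have : (inner ℂ h a * inner ℂ a w).re =
          ‖w‖ * ((starRingEnd ℂ) (inner ℂ a h) * inner ℂ a e).re := by
        conv_lhs => rw [hwe]
        rw [inner_smul_right, mul_left_comm, Complex.re_ofReal_mul, inner_conj_symm]
      rw [this, abs_mul, abs_norm]
      gcongr

/-! ### Nets by volume comparison -/

/-- The balls of radius `ε / 2` about the points are disjoint and lie in the ball of radius `1 + ε /
2`; compare Haar measures. -/
theorem card_le_of_separated_closedBall {V : Type*} [NormedAddCommGroup V] [NormedSpace ℝ V]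
    [FiniteDimensional ℝ V] {ε : ℝ} (hε : 0 < ε) (s : Finset V) (hs : ∀ c ∈ s, ‖c‖ ≤ 1)
    (h : ∀ c ∈ s, ∀ e ∈ s, c ≠ e → ε ≤ ‖c - e‖) :
    (s.card : ℝ) ≤ (1 + 2 / ε) ^ Module.finrank ℝ V := by
  borelize V
  let μ : Measure V := Measure.addHaar
  have hδ : 0 < ε / 2 := by positivity
  have hρ : 0 < 1 + ε / 2 := by positivity
  have D : (s : Set V).PairwiseDisjoint fun c => Metric.ball (c : V) (ε / 2) := by
    intro c hc e he hce
    apply Metric.ball_disjoint_ball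
    rw [dist_eq_norm]
    linarith [h c hc e he hce]
  have hsub : (⋃ c ∈ s, Metric.ball (c : V) (ε / 2)) ⊆ Metric.ball 0 (1 + ε / 2) := by
    refine Set.iUnion₂_subset fun x hx => Metric.ball_subset_ball' ?_
    rw [dist_zero_right]
    linarith [hs x hx]
  have hμ := measure_mono (μ := μ) hsub
  rw [measure_biUnion_finset D fun c _ => measurableSet_ball] at hμ
  simp only [μ.addHaar_ball_of_pos _ hδ, μ.addHaar_ball_of_pos _ hρ, Finset.sum_const,
    nsmul_eq_mul, ← mul_assoc] at hμ
  have J := (ENNReal.mul_le_mul_iff_left (Metric.measure_ball_pos _ _ zero_lt_one).ne'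
    measure_ball_lt_top.ne).1 hμ
  have K := ENNReal.toReal_le_of_le_ofReal (by positivity) J
  rw [ENNReal.toReal_mul, ENNReal.toReal_natCast, ENNReal.toReal_ofReal (by positivity)] at K
  have e : 1 + 2 / ε = (1 + ε / 2) / (ε / 2) := by field_simp; ring
  rw [e, div_pow, le_div_iff₀ (by positivity)]
  exact K

/-- A separated subset of `S` of largest cardinality, which exists by the volume bound, is a net: a
point far from it could be added. The net lies inside `S`, so its points inherit the constraints
defining `S`. -/
theorem exists_finset_net {V : Type*} [NormedAddCommGroup V] [NormedSpace ℝ V]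
    [FiniteDimensional ℝ V] {ε : ℝ} (hε : 0 < ε) {S : Set V} (hS : ∀ x ∈ S, ‖x‖ ≤ 1) :
    ∃ N : Finset V, (∀ x ∈ N, x ∈ S) ∧ (N.card : ℝ) ≤ (1 + 2 / ε) ^ Module.finrank ℝ V ∧
      ∀ x ∈ S, ∃ y ∈ N, ‖x - y‖ < ε := by
  classical
  let Sep : Finset V → Prop := fun N =>
    (∀ x ∈ N, x ∈ S) ∧ ∀ c ∈ N, ∀ e ∈ N, c ≠ e → ε ≤ ‖c - e‖
  have hcard : ∀ N, Sep N → (N.card : ℝ) ≤ (1 + 2 / ε) ^ Module.finrank ℝ V := fun N hN =>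
    card_le_of_separated_closedBall hε N (fun c hc => hS c (hN.1 c hc)) hN.2
  let p : ℕ → Prop := fun k => ∃ N, Sep N ∧ N.card = k
  set b := ⌊(1 + 2 / ε) ^ Module.finrank ℝ V⌋₊
  have hb : ∀ k, p k → k ≤ b := by
    rintro k ⟨N, hN, rfl⟩
    exact Nat.le_floor (hcard N hN)
  obtain ⟨N, hN, hNc⟩ : p (Nat.findGreatest p b) :=
    Nat.findGreatest_spec (Nat.zero_le b) ⟨∅, by simp [Sep], rfl⟩
  refine ⟨N, hN.1, hcard N hN, fun x hx => ?_⟩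
  by_contra! hfar
  have hxN : x ∉ N := fun hxN => by
    have := hfar x hxN
    simp only [sub_self, norm_zero] at this
    linarith
  have hins : p (N.card + 1) := by
    refine ⟨insert x N, ⟨?_, ?_⟩, Finset.card_insert_of_notMem hxN⟩
    · simp only [Finset.mem_insert]
      rintro y (rfl | hy)
      exacts [hx, hN.1 y hy]
    · simp only [Finset.mem_insert]
      rintro c (rfl | hc) e (rfl | he) hce
      · exact absurd rfl hce
      · exact hfar e he
      · rw [norm_sub_rev]
        exact hfar c hc
      · exact hN.2 c hc e he hce
  have := Nat.le_findGreatest (hb _ hins) hins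
  lia

/-! ### Chernoff bound, and passage from nets to all vectors -/

/-- The Chernoff bound with exponential parameter 1; any other parameter is absorbed into `f`. -/
theorem measureReal_le_sum_comp_le {Ω X : Type*} [MeasurableSpace Ω] [MeasurableSpace X]
    {P : Measure Ω} [IsProbabilityMeasure P] {μ : Measure X} {m : ℕ} {a : Fin m → Ω → X}
    (ha : ∀ j, HasLaw (a j) μ P) (hind : iIndepFun a P) {f : X → ℝ} (hf : Measurable f)
    (hint : Integrable (fun x => Real.exp (f x)) μ) {M : ℝ} (hM : ∫ x, Real.exp (f x) ∂μ ≤ M)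
    (u : ℝ) :
    P.real {ω | u ≤ ∑ j, f (a j ω)} ≤ Real.exp (-u) * M ^ m := by
  have hind' : iIndepFun (fun j ω => f (a j ω)) P := hind.comp (fun _ => f) fun _ => hf
  have hae : ∀ j, AEMeasurable (fun ω => f (a j ω)) P := fun j =>
    hf.comp_aemeasurable (ha j).aemeasurable
  have hmgf : ∀ j, mgf (fun ω => f (a j ω)) P 1 = ∫ x, Real.exp (f x) ∂μ := fun j => by
    simp only [mgf, one_mul]
    rw [← (ha j).map_eq, integral_map (ha j).aemeasurable
      hf.exp.aestronglyMeasurable]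
  have hintj : ∀ j, Integrable (fun ω => Real.exp (1 * f (a j ω))) P := fun j => by
    simp only [one_mul]
    have h := hint
    rw [← (ha j).map_eq, integrable_map_measure hf.exp.aestronglyMeasurable
      (ha j).aemeasurable] at h
    exact h
  have hsum := hind'.mgf_sum₀ (t := 1) hae Finset.univ
  -- A non-integrable exponential would have `mgf` equal to the default value 0, whereas the product
  -- of the individual moment generating functions is positive.
  have hi : Integrable (fun ω => Real.exp (1 * (∑ j, fun ω => f (a j ω)) ω)) P := by
    by_contra hni
    rw [mgf_undef hni] at hsum
    exact (Finset.prod_pos fun j _ => mgf_pos (hintj j)).ne hsum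
  have hc := measure_ge_le_exp_mul_mgf (μ := P) u zero_le_one hi
  rw [hsum] at hc
  simp only [hmgf, Finset.prod_const, Finset.card_univ, Fintype.card_fin, Finset.sum_apply,
    neg_mul, one_mul] at hc
  refine hc.trans ?_
  gcongr

/-- For the operator `A x = (⟨aⱼ, x⟩)ⱼ`, approximation by a 1/2-net gives `‖A‖ ≤ √R + ‖A‖ / 2`,
hence `‖A‖ ≤ 2 √R`. -/
theorem sum_sq_inner_le_of_net {d m : ℕ} (a : Fin m → EuclideanSpace ℂ (Fin d)) {R : ℝ}
    {N : Finset (EuclideanSpace ℂ (Fin d))}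
    (hN : ∀ x, ‖x‖ = 1 → ∃ y ∈ N, ‖x - y‖ < 1 / 2)
    (hNR : ∀ y ∈ N, ∑ j, ‖inner ℂ (a j) y‖ ^ 2 ≤ R) (x : EuclideanSpace ℂ (Fin d)) :
    √(∑ j, ‖inner ℂ (a j) x‖ ^ 2) ≤ 2 * √R * ‖x‖ := by
  let A : EuclideanSpace ℂ (Fin d) →L[ℂ] EuclideanSpace ℂ (Fin m) :=
    LinearMap.toContinuousLinearMap
      { toFun := fun x => WithLp.toLp 2 fun j => inner ℂ (a j) x
        map_add' := fun x y => by ext j; simp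
        map_smul' := fun c x => by ext j; simp }
  have hA : ∀ x, ‖A x‖ = √(∑ j, ‖inner ℂ (a j) x‖ ^ 2) := fun x => EuclideanSpace.norm_eq _
  have hop : ‖A‖ ≤ √R + ‖A‖ / 2 := by
    refine A.opNorm_le_of_unit_norm (𝕜 := ℂ) (by positivity) fun x hx => ?_
    obtain ⟨y, hy, hxy⟩ := hN x hx
    have h1 : ‖A y‖ ≤ √R := by
      rw [hA]
      exact Real.sqrt_le_sqrt (hNR y hy)
    calc ‖A x‖ = ‖A y + A (x - y)‖ := by rw [← map_add]; congr 2; abel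
      _ ≤ ‖A y‖ + ‖A (x - y)‖ := norm_add_le _ _
      _ ≤ √R + ‖A‖ * (1 / 2) := by
        gcongr
        exact (A.le_opNorm _).trans (by gcongr)
      _ = √R + ‖A‖ / 2 := by ring
  rw [← hA]
  refine (A.le_opNorm x).trans ?_
  gcongr
  linarith

theorem sum_abs_cross_le {d m : ℕ} (a : Fin m → EuclideanSpace ℂ (Fin d)) {B : ℝ}
    (hB : ∀ x, √(∑ j, ‖inner ℂ (a j) x‖ ^ 2) ≤ B * ‖x‖) (h s : EuclideanSpace ℂ (Fin d)) :
    ∑ j, |(inner ℂ h (a j) * inner ℂ (a j) s).re| ≤ B ^ 2 * ‖h‖ * ‖s‖ := by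
  calc ∑ j, |(inner ℂ h (a j) * inner ℂ (a j) s).re|
      ≤ ∑ j, ‖inner ℂ (a j) h‖ * ‖inner ℂ (a j) s‖ := by
        refine Finset.sum_le_sum fun j _ => ?_
        refine (Complex.abs_re_le_norm _).trans ?_
        rw [norm_mul, norm_inner_symm]
    _ ≤ √(∑ j, ‖inner ℂ (a j) h‖ ^ 2) * √(∑ j, ‖inner ℂ (a j) s‖ ^ 2) :=
        Real.sum_mul_le_sqrt_mul_sqrt _ _ _
    _ ≤ (B * ‖h‖) * (B * ‖s‖) := by
        gcongr
        · exact (Real.sqrt_nonneg _).trans (hB h)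
        · exact hB h
        · exact hB s
    _ = B ^ 2 * ‖h‖ * ‖s‖ := by ring

/-- Replacing one argument of the form by a net point changes the sum by at most `B² ε`, and there
are two arguments. General vectors are normalised by real factors, which keep the inner product
real. -/
theorem le_sum_abs_cross_of_net {d m : ℕ} (a : Fin m → EuclideanSpace ℂ (Fin d)) {B u ε : ℝ}
    (hB : ∀ x, √(∑ j, ‖inner ℂ (a j) x‖ ^ 2) ≤ B * ‖x‖)
    {N : Finset (EuclideanSpace ℂ (Fin d) × EuclideanSpace ℂ (Fin d))}
    (hN1 : ∀ q ∈ N, ‖q.1‖ ≤ 1)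
    (hN : ∀ h s, ‖h‖ = 1 → ‖s‖ = 1 → (inner ℂ h s).im = 0 → ∃ q ∈ N, ‖(h, s) - q‖ < ε)
    (hNu : ∀ q ∈ N, u ≤ ∑ j, |(inner ℂ q.1 (a j) * inner ℂ (a j) q.2).re|)
    (h s : EuclideanSpace ℂ (Fin d)) (him : (inner ℂ h s).im = 0) :
    (u - 2 * B ^ 2 * ε) * (‖h‖ * ‖s‖) ≤ ∑ j, |(inner ℂ h (a j) * inner ℂ (a j) s).re| := by
  have hunit : ∀ h s : EuclideanSpace ℂ (Fin d), ‖h‖ = 1 → ‖s‖ = 1 → (inner ℂ h s).im = 0 →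
      u - 2 * B ^ 2 * ε ≤ ∑ j, |(inner ℂ h (a j) * inner ℂ (a j) s).re| := by
    intro h s hh hs him
    obtain ⟨q, hq, hd⟩ := hN h s hh hs him
    have hd1 : ‖h - q.1‖ ≤ ε := (norm_fst_le ((h, s) - q)).trans hd.le
    have hd2 : ‖s - q.2‖ ≤ ε := (norm_snd_le ((h, s) - q)).trans hd.le
    have h1 := sum_abs_cross_le a hB (h - q.1) s
    have h2 := sum_abs_cross_le a hB q.1 (s - q.2)
    have hsplit : ∑ j, |(inner ℂ q.1 (a j) * inner ℂ (a j) q.2).re| ≤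
        ∑ j, |(inner ℂ h (a j) * inner ℂ (a j) s).re| +
        ∑ j, |(inner ℂ (h - q.1) (a j) * inner ℂ (a j) s).re| +
        ∑ j, |(inner ℂ q.1 (a j) * inner ℂ (a j) (s - q.2)).re| := by
      rw [← Finset.sum_add_distrib, ← Finset.sum_add_distrib]
      refine Finset.sum_le_sum fun j _ => ?_
      have : (inner ℂ q.1 (a j) * inner ℂ (a j) q.2).re =
          (inner ℂ h (a j) * inner ℂ (a j) s).re -
          (inner ℂ (h - q.1) (a j) * inner ℂ (a j) s).re -
          (inner ℂ q.1 (a j) * inner ℂ (a j) (s - q.2)).re := by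
        rw [← Complex.sub_re, ← Complex.sub_re, inner_sub_left, inner_sub_right]
        congr 1
        ring
      rw [this]
      exact (abs_sub _ _).trans (by gcongr; exact abs_sub _ _)
    have b1 : B ^ 2 * ‖h - q.1‖ * ‖s‖ ≤ B ^ 2 * ε := by
      rw [hs, mul_one]
      gcongr
    have b2 : B ^ 2 * ‖q.1‖ * ‖s - q.2‖ ≤ B ^ 2 * ε := by
      calc B ^ 2 * ‖q.1‖ * ‖s - q.2‖ ≤ B ^ 2 * 1 * ε := by
            gcongr
            exact hN1 q hq
        _ = B ^ 2 * ε := by ring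
    linarith [hNu q hq]
  rcases eq_or_ne h 0 with rfl | hh
  · simp
  rcases eq_or_ne s 0 with rfl | hs
  · simp
  have hh' : 0 < ‖h‖ := norm_pos_iff.2 hh
  have hs' : 0 < ‖s‖ := norm_pos_iff.2 hs
  have hscale : ∀ c e : ℝ, ∀ x y z w : EuclideanSpace ℂ (Fin d),
      inner ℂ ((c : ℂ) • x) y * inner ℂ z ((e : ℂ) • w) =
      ((c * e : ℝ) : ℂ) * (inner ℂ x y * inner ℂ z w) := by
    intro c e x y z w
    rw [inner_smul_left, inner_smul_right, Complex.conj_ofReal]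
    push_cast
    ring
  have key := hunit (((‖h‖⁻¹ : ℝ) : ℂ) • h) (((‖s‖⁻¹ : ℝ) : ℂ) • s)
    (by rw [norm_smul, Complex.norm_real, norm_inv, norm_norm, inv_mul_cancel₀ hh'.ne'])
    (by rw [norm_smul, Complex.norm_real, norm_inv, norm_norm, inv_mul_cancel₀ hs'.ne'])
    (by rw [inner_smul_left, inner_smul_right, Complex.conj_ofReal, Complex.im_ofReal_mul,
      Complex.im_ofReal_mul, him, mul_zero, mul_zero])
  simp only [hscale, Complex.re_ofReal_mul, abs_mul] at key
  rw [← Finset.mul_sum, abs_of_pos (by positivity : (0 : ℝ) < ‖h‖⁻¹),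
    abs_of_pos (by positivity : (0 : ℝ) < ‖s‖⁻¹), ← mul_inv, ← div_eq_inv_mul,
    le_div_iff₀ (by positivity)] at key
  exact key

/-! ### Deterministic stability of minimizers -/

theorem exists_phase_inner_eq_norm {d : ℕ} (x y : EuclideanSpace ℂ (Fin d)) :
    ∃ θ ∈ Set.Ico 0 (2 * Real.pi),
      inner ℂ x (Complex.exp (Complex.I * (θ : ℝ)) • y) = (‖inner ℂ x y‖ : ℂ) := by
  set z := inner ℂ x y with hz
  refine ⟨toIcoMod Real.two_pi_pos 0 (-z.arg), ?_, ?_⟩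
  · simpa using toIcoMod_mem_Ico Real.two_pi_pos 0 (-z.arg)
  · have he : Complex.exp (Complex.I * (toIcoMod Real.two_pi_pos 0 (-z.arg) : ℝ)) =
        Complex.exp (Complex.I * (-z.arg : ℝ)) := by
      rw [Complex.exp_eq_exp_iff_exists_int]
      refine ⟨-toIcoDiv Real.two_pi_pos 0 (-z.arg), ?_⟩
      rw [toIcoMod, zsmul_eq_mul]
      push_cast
      ring
    rw [inner_smul_right, ← hz, he]
    calc Complex.exp (Complex.I * (-z.arg : ℝ)) * z
        = Complex.exp (Complex.I * (-z.arg : ℝ)) * (‖z‖ * Complex.exp (z.arg * Complex.I)) := by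
          rw [Complex.norm_mul_exp_arg_mul_I]
      _ = (‖z‖ : ℂ) := by
          rw [mul_left_comm, ← Complex.exp_add]
          simp [mul_comm]

/-- The lower isometry bound for the intensity map gives control of the distance up to phase. -/
theorem phaseDist_bounds {d m : ℕ} (a : Fin m → EuclideanSpace ℂ (Fin d)) {v : ℝ}
    (hlow : ∀ h s, (inner ℂ h s).im = 0 →
      v * (‖h‖ * ‖s‖) ≤ ∑ j, |(inner ℂ h (a j) * inner ℂ (a j) s).re|) (hv : 0 ≤ v)
    (x y : EuclideanSpace ℂ (Fin d)) :
    v * phaseDist x y ^ 2 ≤ ∑ j, |‖inner ℂ (a j) x‖ ^ 2 - ‖inner ℂ (a j) y‖ ^ 2| ∧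
    v * (phaseDist x y * ‖y‖) ≤ ∑ j, |‖inner ℂ (a j) x‖ ^ 2 - ‖inner ℂ (a j) y‖ ^ 2| := by
  obtain ⟨θ, hθ, hin⟩ := exists_phase_inner_eq_norm x y
  set e := Complex.exp (Complex.I * (θ : ℝ)) with he
  have hen : ‖e‖ = 1 := by rw [he, mul_comm, Complex.norm_exp_ofReal_mul_I]
  set y' := e • y with hy'
  have hyn : ‖y'‖ = ‖y‖ := by rw [hy', norm_smul, hen, one_mul]
  have hd : phaseDist x y ≤ ‖x - y'‖ := (phaseDist_isLeast x y).2 ⟨θ, hθ, rfl⟩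
  have hd0 : 0 ≤ phaseDist x y := by
    obtain ⟨t, -, ht⟩ := (phaseDist_isLeast x y).1
    rw [← ht]
    exact norm_nonneg _
  have hin' : inner ℂ y' x = (‖inner ℂ x y‖ : ℂ) := by
    rw [← inner_conj_symm, hin, Complex.conj_ofReal]
  have him : (inner ℂ (x - y') (x + y')).im = 0 := by
    rw [inner_sub_left, inner_add_right, inner_add_right, hin, hin', inner_self_eq_norm_sq_to_K,
      inner_self_eq_norm_sq_to_K]
    simp [← Complex.ofReal_pow]
  have hplus : ‖x + y'‖ ^ 2 = ‖x‖ ^ 2 + 2 * ‖inner ℂ x y‖ + ‖y‖ ^ 2 := by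
    rw [@norm_add_sq ℂ, hin, hyn]
    simp
  have hminus : ‖x - y'‖ ^ 2 = ‖x‖ ^ 2 - 2 * ‖inner ℂ x y‖ + ‖y‖ ^ 2 := by
    rw [@norm_sub_sq ℂ, hin, hyn]
    simp
  have hi0 : 0 ≤ ‖inner ℂ x y‖ := norm_nonneg _
  have hs1 : ‖x - y'‖ ≤ ‖x + y'‖ := by
    rw [← sq_le_sq₀ (norm_nonneg _) (norm_nonneg _)]
    linarith
  have hs2 : ‖y‖ ≤ ‖x + y'‖ := by
    rw [← sq_le_sq₀ (norm_nonneg _) (norm_nonneg _)]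
    nlinarith [sq_nonneg ‖x‖]
  have hcross : ∀ j, (inner ℂ (x - y') (a j) * inner ℂ (a j) (x + y')).re =
      ‖inner ℂ (a j) x‖ ^ 2 - ‖inner ℂ (a j) y‖ ^ 2 := by
    intro j
    have hay : ‖inner ℂ (a j) y‖ = ‖inner ℂ (a j) y'‖ := by
      rw [hy', inner_smul_right, norm_mul, hen, one_mul]
    rw [hay, ← inner_conj_symm, inner_sub_right, inner_add_right, Complex.sq_norm, Complex.sq_norm,
      Complex.normSq_apply, Complex.normSq_apply]
    generalize inner ℂ (a j) x = u
    generalize inner ℂ (a j) y' = v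
    simp
    ring
  have hl := hlow _ _ him
  simp only [hcross] at hl
  constructor <;> refine le_trans ?_ hl
  · rw [sq]
    gcongr
    exact hd.trans hs1
  · gcongr

/-- The loss at `x₀` is `‖η‖²`, so the vector `q` of intensity differences satisfies `‖q - η‖ ≤
‖η‖`, hence `‖q‖ ≤ 2 ‖η‖`. Cauchy–Schwarz turns this into an ℓ¹ bound. -/
theorem sum_abs_intensity_sub_le_of_isMinOn {d m : ℕ} (a : Fin m → EuclideanSpace ℂ (Fin d))
    (x₀ xhat : EuclideanSpace ℂ (Fin d)) (η : EuclideanSpace ℝ (Fin m))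
    (hmin : IsMinOn (intensityLoss a (intensityData a x₀ η)) Set.univ xhat) :
    ∑ j, |‖inner ℂ (a j) xhat‖ ^ 2 - ‖inner ℂ (a j) x₀‖ ^ 2| ≤ √m * (2 * ‖η‖) := by
  let q : EuclideanSpace ℝ (Fin m) :=
    WithLp.toLp 2 fun j => ‖inner ℂ (a j) xhat‖ ^ 2 - ‖inner ℂ (a j) x₀‖ ^ 2
  have h1 := isMinOn_iff.1 hmin x₀ (Set.mem_univ _)
  have h2 : ‖q - η‖ ≤ ‖η‖ := by
    rw [← sq_le_sq₀ (norm_nonneg _) (norm_nonneg _), EuclideanSpace.norm_sq_eq,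
      EuclideanSpace.norm_sq_eq]
    simpa [intensityLoss, intensityData, q, sub_sub] using h1
  have h3 : ‖q‖ ≤ 2 * ‖η‖ := by
    calc ‖q‖ = ‖(q - η) + η‖ := by rw [sub_add_cancel]
      _ ≤ ‖q - η‖ + ‖η‖ := norm_add_le _ _
      _ ≤ 2 * ‖η‖ := by linarith
  calc ∑ j, |‖inner ℂ (a j) xhat‖ ^ 2 - ‖inner ℂ (a j) x₀‖ ^ 2| = ∑ j, 1 * ‖q j‖ := by
        simp [q]
    _ ≤ √(∑ _j : Fin m, 1 ^ 2) * √(∑ j, ‖q j‖ ^ 2) := Real.sum_mul_le_sqrt_mul_sqrt _ _ _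
    _ = √m * ‖q‖ := by rw [EuclideanSpace.norm_eq]; simp
    _ ≤ √m * (2 * ‖η‖) := by gcongr

theorem phaseDist_le_intensityErrorRate {d m : ℕ} (hm : 0 < m)
    (a : Fin m → EuclideanSpace ℂ (Fin d)) {c : ℝ} (hc : 0 < c)
    (hlow : ∀ h s, (inner ℂ h s).im = 0 →
      c * m * (‖h‖ * ‖s‖) ≤ ∑ j, |(inner ℂ h (a j) * inner ℂ (a j) s).re|)
    (x₀ xhat : EuclideanSpace ℂ (Fin d)) (η : EuclideanSpace ℝ (Fin m))
    (hmin : IsMinOn (intensityLoss a (intensityData a x₀ η)) Set.univ xhat) :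
    phaseDist xhat x₀ ≤ (√(2 / c) + 2 / c) * intensityErrorRate x₀ η := by
  have hm' : (0 : ℝ) < m := by exact_mod_cast hm
  have hsm : 0 < √(m : ℝ) := Real.sqrt_pos.2 hm'
  obtain ⟨h1, h2⟩ := phaseDist_bounds a hlow (by positivity) xhat x₀
  have h3 := sum_abs_intensity_sub_le_of_isMinOn a x₀ xhat η hmin
  have hmm : (m : ℝ) = √m * √m := (Real.mul_self_sqrt hm'.le).symm
  -- The quadratic bound gives the first rate with constant `√(2 / c)`, and the linear one below
  -- gives the second with `2 / c`; the sum of the constants serves for both.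
  have hquad : phaseDist xhat x₀ ^ 2 ≤ 2 / c * (‖η‖ / √m) := by
    rw [div_mul_div_comm, le_div_iff₀ (by positivity)]
    refine le_of_mul_le_mul_left ?_ hsm
    calc √m * (phaseDist xhat x₀ ^ 2 * (c * √m)) = c * (√m * √m) * phaseDist xhat x₀ ^ 2 := by ring
      _ ≤ _ := by rw [← hmm]; exact h1.trans h3
  have hlin : phaseDist xhat x₀ * ‖x₀‖ ≤ 2 / c * (‖η‖ / √m) := by
    rw [div_mul_div_comm, le_div_iff₀ (by positivity)]
    refine le_of_mul_le_mul_left ?_ hsm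
    calc √m * (phaseDist xhat x₀ * ‖x₀‖ * (c * √m)) =
        c * (√m * √m) * (phaseDist xhat x₀ * ‖x₀‖) := by ring
      _ ≤ _ := by rw [← hmm]; exact h2.trans h3
  have hroot : √(√(m : ℝ)) = (m : ℝ) ^ (1 / 4 : ℝ) := by
    rw [Real.sqrt_eq_rpow, Real.sqrt_eq_rpow, ← Real.rpow_mul hm'.le]
    norm_num
  have hfirst : phaseDist xhat x₀ ≤
      (√(2 / c) + 2 / c) * (√‖η‖ / (m : ℝ) ^ (1 / 4 : ℝ)) := by
    calc phaseDist xhat x₀ ≤ √(2 / c * (‖η‖ / √m)) := Real.le_sqrt_of_sq_le hquad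
      _ = √(2 / c) * (√‖η‖ / (m : ℝ) ^ (1 / 4 : ℝ)) := by
        rw [Real.sqrt_mul (by positivity), Real.sqrt_div (norm_nonneg _), hroot]
      _ ≤ _ := by
        gcongr
        exact le_add_of_nonneg_right (by positivity)
  unfold intensityErrorRate
  split_ifs with hx
  · exact hfirst
  · have hx' : 0 < ‖x₀‖ := norm_pos_iff.2 hx
    rw [mul_min_of_nonneg _ _ (by positivity)]
    refine le_min hfirst ?_
    calc phaseDist xhat x₀ ≤ 2 / c * (‖η‖ / √m) / ‖x₀‖ := (le_div_iff₀ hx').2 hlin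
      _ = 2 / c * (‖η‖ / (‖x₀‖ * √m)) := by field_simp
      _ ≤ _ := by
        gcongr
        exact le_add_of_nonneg_left (by positivity)

/-! ### The uniform lower bound with high probability, and the conclusion -/

/-- Exponential moments of the squared modulus of a complex Gaussian marginal. -/
theorem exists_integral_exp_sq_inner_le :
    ∃ c M : ℝ, 0 < c ∧ 0 < M ∧ ∀ (d : ℕ) (y : EuclideanSpace ℂ (Fin d)), ‖y‖ = 1 →
      Integrable (fun a => Real.exp (c * ‖inner ℂ a y‖ ^ 2)) (complexGaussian d) ∧
      ∫ a, Real.exp (c * ‖inner ℂ a y‖ ^ 2) ∂(complexGaussian d) ≤ M := by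
  obtain ⟨c, hc, hint⟩ := exists_integrable_exp_complexGaussian 1
  have hnorm : ∀ z : EuclideanSpace ℂ (Fin 1), ‖z‖ = ‖z 0‖ := fun z => by
    simp [EuclideanSpace.norm_eq]
  simp only [hnorm] at hint
  have hpos : 0 < ∫ z, Real.exp (c * ‖z 0‖ ^ 2) ∂(complexGaussian 1) := integral_exp_pos hint
  refine ⟨c, _, hc, hpos, fun d y hy => ?_⟩
  have heq := integral_comp_inner_eq hy (fun z => Real.exp (c * ‖z‖ ^ 2)) (by fun_prop)
  refine ⟨?_, heq.le⟩
  -- A non-integrable function would have integral 0 by convention, but the integral equals a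
  -- positive one.
  by_contra hni
  rw [integral_undef hni] at heq
  exact hpos.ne heq

/-- `HasLaw` gives only almost everywhere measurability, so the bad event may fail to be measurable;
its measurable hull has the same probability. -/
theorem one_sub_le_measureReal_compl_toMeasurable {Ω : Type*} [MeasurableSpace Ω] {P : Measure Ω}
    [IsProbabilityMeasure P] {B : Set Ω} {δ : ℝ} (hB : P.real B ≤ δ) :
    1 - δ ≤ P.real (toMeasurable P B)ᶜ := by
  rw [probReal_compl_eq_one_sub (measurableSet_toMeasurable P B), measureReal_def,
    measure_toMeasurable, ← measureReal_def]
  linarith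

theorem measureReal_biUnion_finset_le_card_mul {Ω ι : Type*} [MeasurableSpace Ω] {P : Measure Ω}
    [IsProbabilityMeasure P] (N : Finset ι) (B : ι → Set Ω) {b p : ℝ} (hp : 0 ≤ p)
    (hN : (N.card : ℝ) ≤ b) (hB : ∀ i ∈ N, P.real (B i) ≤ p) :
    P.real (⋃ i ∈ N, B i) ≤ b * p :=
  calc P.real (⋃ i ∈ N, B i) ≤ ∑ i ∈ N, P.real (B i) := measureReal_biUnion_finset_le _ _
    _ ≤ ∑ _i ∈ N, p := Finset.sum_le_sum hB
    _ = N.card * p := by simp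
    _ ≤ b * p := by gcongr

theorem finrank_real_euclideanSpace_complex (d : ℕ) :
    Module.finrank ℝ (EuclideanSpace ℂ (Fin d)) = 2 * d := by
  rw [← Module.finrank_mul_finrank ℝ ℂ, Complex.finrank_real_complex, finrank_euclideanSpace_fin]

/-- With overwhelming probability the rank-two lower isometry bound holds uniformly. -/
theorem exists_uniform_lower_bound :
    ∃ K v c : ℝ, 0 < K ∧ 0 < v ∧ 0 < c ∧
      ∀ (d m : ℕ), 1 ≤ d → K * (d : ℝ) ≤ (m : ℝ) →
      ∀ (Ω : Type*) [MeasurableSpace Ω] (P : Measure Ω) [IsProbabilityMeasure P]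
        (a : Fin m → Ω → EuclideanSpace ℂ (Fin d)),
        (∀ j, HasLaw (a j) (complexGaussian d) P) → iIndepFun a P →
        ∃ E : Set Ω, MeasurableSet E ∧ 1 - Real.exp (-(c * (m : ℝ))) ≤ P.real E ∧
          ∀ ω ∈ E, ∀ h s, (inner ℂ h s).im = 0 → v * m * (‖h‖ * ‖s‖) ≤
            ∑ j, |(inner ℂ h (a j ω) * inner ℂ (a j ω) s).re| := by
  obtain ⟨r, hr0, hr1, hr⟩ := exists_integral_exp_neg_abs_cross_le
  obtain ⟨l, M, hl, hM, hexp⟩ := exists_integral_exp_sq_inner_le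
  -- With `r = exp(-2t)`, the sum is at most `t m` with probability at most `exp(t m) r^m = exp(-t
  -- m)`.
  set t := -Real.log r / 2 with ht
  have ht0 : 0 < t := by
    have := Real.log_neg hr0 hr1
    rw [ht]
    linarith
  have hrt : r = Real.exp (-(2 * t)) := by
    rw [ht, show -(2 * (-Real.log r / 2)) = Real.log r by ring, Real.exp_log hr0]
  -- Chosen so that `exp(-l T m) M^m ≤ exp(-t m)`; the 1 only ensures positivity.
  set T := max 1 ((t + Real.log M) / l) with hT
  have hT0 : 0 < T := lt_of_lt_of_le one_pos (le_max_left _ _)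
  have hTl : t + Real.log M ≤ l * T := by
    rw [← div_le_iff₀' hl]
    exact le_max_right _ _
  -- With `B = 2 √(T m)` the net error `2 B² ε` equals `t m / 2`, half of the level `t m` reached on
  -- the net.
  set ε := t / (16 * T) with hε
  have hε0 : 0 < ε := by positivity
  -- The nets live in real dimensions `2d` and `4d`; as `d ≥ 1`, the sum of their size bounds is at
  -- most `D^d`, and `m ≥ (2 log D / t) d` makes this at most `exp(t m / 2)`.
  set D := (1 + 2 / (1 / 2 : ℝ)) ^ 2 + (1 + 2 / ε) ^ 4 with hD
  have hD1 : 1 < D := by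
    have : 0 < (1 + 2 / ε) ^ 4 := by positivity
    rw [hD]
    linarith [show (1 + 2 / (1 / 2 : ℝ)) ^ 2 = 25 by norm_num]
  have hlogD : 0 < Real.log D := Real.log_pos hD1
  refine ⟨2 * Real.log D / t, t / 2, t / 2, by positivity, by positivity, by positivity, ?_⟩
  intro d m hd hKm Ω _ P _ a ha hind
  obtain ⟨N₁, hN₁S, hN₁c, hN₁⟩ := exists_finset_net (V := EuclideanSpace ℂ (Fin d))
    (one_half_pos (α := ℝ)) (S := {x | ‖x‖ = 1}) fun x hx => le_of_eq hx
  obtain ⟨N₂, hN₂S, hN₂c, hN₂⟩ := exists_finset_net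
    (V := EuclideanSpace ℂ (Fin d) × EuclideanSpace ℂ (Fin d)) hε0
    (S := {q | ‖q.1‖ = 1 ∧ ‖q.2‖ = 1 ∧ (inner ℂ q.1 q.2).im = 0})
    fun q hq => norm_prod_le_iff.2 ⟨hq.1.le, hq.2.1.le⟩
  rw [finrank_real_euclideanSpace_complex] at hN₁c
  rw [Module.finrank_prod, finrank_real_euclideanSpace_complex,
    show 2 * d + 2 * d = 4 * d by ring] at hN₂c
  set p := Real.exp (-(t * m)) with hp
  have hp0 : 0 < p := Real.exp_pos _
  have hB₁ : ∀ y ∈ N₁,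
      P.real {ω | l * T * m ≤ ∑ j, l * ‖inner ℂ (a j ω) y‖ ^ 2} ≤ p := by
    intro y hy
    obtain ⟨hint, hle⟩ := hexp d y (hN₁S y hy)
    refine (measureReal_le_sum_comp_le ha hind (f := fun x => l * ‖inner ℂ x y‖ ^ 2)
      (by fun_prop) hint hle _).trans ?_
    rw [← Real.exp_log hM, ← Real.exp_nat_mul, ← Real.exp_add, hp, Real.exp_le_exp]
    nlinarith [(Nat.cast_nonneg m : (0 : ℝ) ≤ m)]
  have hB₂ : ∀ q ∈ N₂, P.real {ω | -(t * m) ≤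
      ∑ j, -|(inner ℂ q.1 (a j ω) * inner ℂ (a j ω) q.2).re|} ≤ p := by
    intro q hq
    obtain ⟨h1, h2, h3⟩ := hN₂S q hq
    refine (measureReal_le_sum_comp_le ha hind
      (f := fun x => -|(inner ℂ q.1 x * inner ℂ x q.2).re|) (by fun_prop)
      (integrable_exp_neg_abs _ (by fun_prop)) (hr d q.1 q.2 h1 h2 h3) _).trans ?_
    rw [hrt, ← Real.exp_nat_mul, ← Real.exp_add, hp, Real.exp_le_exp]
    linarith
  set B := (⋃ y ∈ N₁, {ω | l * T * m ≤ ∑ j, l * ‖inner ℂ (a j ω) y‖ ^ 2}) ∪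
    (⋃ q ∈ N₂, {ω | -(t * m) ≤ ∑ j, -|(inner ℂ q.1 (a j ω) * inner ℂ (a j ω) q.2).re|})
    with hB
  have hPB : P.real B ≤ Real.exp (-(t / 2 * m)) := by
    have hDd : (1 + 2 / (1 / 2 : ℝ)) ^ (2 * d) + (1 + 2 / ε) ^ (4 * d) ≤ D ^ d := by
      rw [pow_mul, pow_mul, hD]
      exact pow_add_pow_le (by positivity) (by positivity) (by lia)
    have hDm : D ^ d ≤ Real.exp (t / 2 * m) := by
      rw [← Real.exp_log (one_pos.trans hD1), ← Real.exp_nat_mul, Real.exp_le_exp]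
      rw [div_mul_eq_mul_div, div_le_iff₀ ht0] at hKm
      linarith
    calc P.real B ≤ (1 + 2 / (1 / 2 : ℝ)) ^ (2 * d) * p + (1 + 2 / ε) ^ (4 * d) * p :=
          (measureReal_union_le _ _).trans (add_le_add
            (measureReal_biUnion_finset_le_card_mul N₁ _ hp0.le hN₁c hB₁)
            (measureReal_biUnion_finset_le_card_mul N₂ _ hp0.le hN₂c hB₂))
      _ ≤ Real.exp (t / 2 * m) * p := by
          rw [← add_mul]
          gcongr
          exact hDd.trans hDm
      _ = Real.exp (-(t / 2 * m)) := by
          rw [hp, ← Real.exp_add]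
          congr 1
          ring
  refine ⟨(toMeasurable P B)ᶜ, (measurableSet_toMeasurable P B).compl,
    one_sub_le_measureReal_compl_toMeasurable hPB, fun ω hω => ?_⟩
  have hωB : ω ∉ B := fun h => hω (subset_toMeasurable P B h)
  simp only [hB, Set.mem_union, Set.mem_iUnion, Set.mem_ofPred_eq, not_or, not_exists, not_le]
    at hωB
  have hm0 : (0 : ℝ) ≤ m := Nat.cast_nonneg m
  have hnet := sum_sq_inner_le_of_net (fun j => a j ω) (R := T * m)
    (N := N₁) (fun x hx => hN₁ x hx) fun y hy => by
      have := hωB.1 y hy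
      rw [← Finset.mul_sum, mul_assoc] at this
      exact (lt_of_mul_lt_mul_left this hl.le).le
  intro h s him
  have hmain := le_sum_abs_cross_of_net (fun j => a j ω) (u := t * m) hnet (N := N₂)
    (fun q hq => (hN₂S q hq).1.le) (fun h s h1 h2 h3 => hN₂ (h, s) ⟨h1, h2, h3⟩)
    (fun q hq => by
      have := hωB.2 q hq
      rw [Finset.sum_neg_distrib, neg_lt_neg_iff] at this
      exact this.le) h s him
  refine le_of_eq_of_le ?_ hmain
  rw [mul_pow, Real.sq_sqrt (by positivity), hε]
  field_simp
  ring

theorem mainTheorem1 :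
    ∃ K C c : ℝ, 0 < K ∧ 0 < C ∧ 0 < c ∧
      ∀ (d m : ℕ), 1 ≤ d → K * (d : ℝ) ≤ (m : ℝ) →
      ∀ (Ω : Type*) [MeasurableSpace Ω] (P : Measure Ω) [IsProbabilityMeasure P]
        (a : Fin m → Ω → EuclideanSpace ℂ (Fin d)),
        (∀ j, HasLaw (a j) (complexGaussian d) P) → iIndepFun a P →
        ∃ E : Set Ω, MeasurableSet E ∧ 1 - Real.exp (-(c * (m : ℝ))) ≤ P.real E ∧
          ∀ ω ∈ E, ∀ (x₀ : EuclideanSpace ℂ (Fin d)) (η : EuclideanSpace ℝ (Fin m))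
            (xhat : EuclideanSpace ℂ (Fin d)),
            IsMinOn (intensityLoss (fun j => a j ω) (intensityData (fun j => a j ω) x₀ η))
              Set.univ xhat →
            phaseDist xhat x₀ ≤ C * intensityErrorRate x₀ η := by
  obtain ⟨K, v, c, hK, hv, hc, hE⟩ := exists_uniform_lower_bound
  refine ⟨K, √(2 / v) + 2 / v, c, hK, by positivity, hc, ?_⟩
  intro d m hd hKm Ω _ P _ a ha hind
  obtain ⟨E, hEm, hEP, hlow⟩ := hE d m hd hKm Ω P a ha hind
  have hm : 0 < m := by
    have : (0 : ℝ) < d := by exact_mod_cast hd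
    exact_mod_cast (mul_pos hK this).trans_le hKm
  exact ⟨E, hEm, hEP, fun ω hω x₀ η xhat hmin =>
    phaseDist_le_intensityErrorRate hm (fun j => a j ω) hv (hlow ω hω) x₀ xhat η hmin⟩
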